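/- **Setting.** For $n\in\mathbb N$ let $\mathcal A_n$ be the linear order $\{0,\dots,n\}$ with the constants $min=0$ and $max=n$, the order $<$ and the successor relation $succ$ ($succ(a,b)$ iff $b=a+1$). An *interpretation* is a pair $(\mathcal A_n,\alpha)$ with $n\in\mathbb N$ and $\alpha:\{x,y,z\}\to\{0,\dots,n\}$; put $\alpha(min)=0$ and $\alpha(max)=n$. Let $t\ge 1$. A $\mathcal C_3^t$-formula is built from the atoms $s=s'$, $s<s'$, $succ(s,s')$ with $s,s'\in\{min,max,x,y,z\}$ by $\neg$, $\vee$, $\wedge$ and the quantifiers $\exists^{\ge k}u$, $\forall^{\ge k}u$ with $u\in\{x,y,z\}$ and $k\le t$. Here $\exists^{\ge k}u\,\varphi$ says that at least $k$ distinct values of $u$ satisfy $\varphi$, and $\forall^{\ge k}u\,\varphi$ stands for $\neg\exists^{\ge k}u\,\neg\varphi$ (the ordinary quantifiers are the case $k=1$). The size is given by $|\varphi|=1$ for atoms, $|\neg\varphi|=|\varphi|+1$, $|\varphi\vee\chi|=|\varphi\wedge\chi|=|\varphi|+|\chi|$, and $|\exists^{\ge k}u\,\varphi|=|\forall^{\ge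 k}u\,\varphi|=1+|\varphi|$. For sets $A,B$ of interpretations, $(A,B)\models\psi$ means that $\psi$ is true in every member of $A$ and false in every member of $B$. Let $\mathcal P_2(S)$ be the set of two-element subsets of $S$. A map $\delta:\mathcal P_2(\{min,max,x,y,z\})\to\mathbb N$ is a *separator for* $\langle A,B\rangle$ if for all $(\mathcal A,\alpha)\in A$ and $(\mathcal B,\beta)\in B$ there are $u\ne u'$ in $\{min,max,x,y,z\}$ such that either the order type ($<$, $=$ or $>$) of $(\alpha(u),\alpha(u'))$ differs from that of $(\beta(u),\beta(u'))$, or $|\alpha(u)-\alpha(u')|\ne|\beta(u)-\beta(u')|$ and $\min\big(|\alpha(u)-\alpha(u')|,|\beta(u)-\beta(u')|\big)\le\delta(\{u,u'\})$. Put $$b(\delta)=\max\big(\{\delta(\{min,max\})\}\cup\{\delta(\{min,u\})+\delta(\{u',max\}):u,u'\in\{x,y,z\}\}\big),$$ $$c(\delta)=\max\{\delta(p)+\delta(q):p,q\in\mathcal P_2(\{x,y,z\}),\ p\ne q\},\qquad w(\delta)=\sqrt{c(\delta)^2+b(\delta)}.$$ A *minimal separator* for $\langle A,B\rangle$ is a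 separator for $\langle A,B\rangle$ of minimal weight $w(\delta)$. **Theorem.** Let $t\ge1$, let $A$ and $B$ be sets of interpretations and let $\psi$ be a $\mathcal C_3^t$-formula with $(A,B)\models\psi$. If $\delta$ is a minimal separator for $\langle A,B\rangle$, then $$|\psi|\ \ge\ \frac{w(\delta)}{t}.$$ -/

import Mathlib

namespace OrderLogic

/-- The three variables of the logic. -/
inductive Var
  | x | y | z
  deriving DecidableEq

instance : Fintype Var := ⟨{.x, .y, .z}, fun u => by cases u <;> decide⟩

/-- The five terms: the two constants and the three variables. -/
inductive Tm
  | min | max | x | y | z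
  deriving DecidableEq

instance : Fintype Tm := ⟨{.min, .max, .x, .y, .z}, fun u => by cases u <;> decide⟩

/-- A variable as a term. -/
def Var.toTm : Var → Tm
  | .x => .x
  | .y => .y
  | .z => .z

/-- The binary relation symbols: equality, order, and successor. -/
inductive Rel
  | eq | lt | succ

/-- Three-variable counting logic over the signature `min, max, <, succ`.
`atLeast k u φ` is `∃^{≥k} u φ` and `forallAtLeast k u φ` is `∀^{≥k} u φ`;
the ordinary quantifiers are the case `k = 1`. -/
inductive Formula
  | atom (r : Rel) (s s' : Tm)
  | neg (φ : Formula)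
  | or (φ χ : Formula)
  | and (φ χ : Formula)
  | atLeast (k : ℕ) (u : Var) (φ : Formula)
  | forallAtLeast (k : ℕ) (u : Var) (φ : Formula)

/-- The size of a formula. -/
def Formula.size : Formula → ℕ
  | .atom _ _ _ => 1
  | .neg φ => φ.size + 1
  | .or φ χ => φ.size + χ.size
  | .and φ χ => φ.size + χ.size
  | .atLeast _ _ φ => 1 + φ.size
  | .forallAtLeast _ _ φ => 1 + φ.size

/-- The counting rank of a formula: the maximal `k` of its counting quantifiers. -/
def Formula.countingRank : Formula → ℕ
  | .atom _ _ _ => 0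
  | .neg φ => φ.countingRank
  | .or φ χ => max φ.countingRank χ.countingRank
  | .and φ χ => max φ.countingRank χ.countingRank
  | .atLeast k _ φ => max k φ.countingRank
  | .forallAtLeast k _ φ => max k φ.countingRank

/-- The value of a term in the linear order `{0, …, n}` under an assignment. -/
def Tm.val {n : ℕ} (α : Var → Fin (n + 1)) : Tm → ℕ
  | .min => 0
  | .max => n
  | .x => α .x
  | .y => α .y
  | .z => α .z

/-- The meaning of the relation symbols on the natural numbers. -/
def Rel.holds : Rel → ℕ → ℕ → Prop
  | .eq, a, b => a = b
  | .lt, a, b => a < b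
  | .succ, a, b => b = a + 1

/-- Satisfaction in the linear order `{0, …, n}` under the assignment `α`. -/
def Formula.Sat {n : ℕ} : Formula → (Var → Fin (n + 1)) → Prop
  | .atom r s s', α => r.holds (s.val α) (s'.val α)
  | .neg φ, α => ¬ φ.Sat α
  | .or φ χ, α => φ.Sat α ∨ χ.Sat α
  | .and φ χ, α => φ.Sat α ∧ χ.Sat α
  | .atLeast k u φ, α =>
      ∃ S : Finset (Fin (n + 1)), S.card = k ∧ ∀ a ∈ S, φ.Sat (Function.update α u a)
  | .forallAtLeast k u φ, α =>
      ¬ ∃ S : Finset (Fin (n + 1)), S.card = k ∧ ∀ a ∈ S, ¬ φ.Sat (Function.update α u a)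

/-- An interpretation: a finite linear order `{0, …, n}` with an assignment of the variables. -/
structure Interp where
  n : ℕ
  α : Var → Fin (n + 1)

/-- The value of a term in an interpretation. -/
def Interp.val (I : Interp) (u : Tm) : ℕ := u.val I.α

/-- `(A, B) ⊨ ψ`: the formula holds throughout `A` and fails throughout `B`. -/
def Distinguishes (A B : Set Interp) (ψ : Formula) : Prop :=
  (∀ I ∈ A, ψ.Sat I.α) ∧ ∀ J ∈ B, ¬ ψ.Sat J.α

/-- The two-element subsets of `{min, max, x, y, z}`. -/
abbrev Pair := {p : Finset Tm // p.card = 2}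

/-- The pair `{u, u'}` of two different terms. -/
def mkPair (u u' : Tm) (h : u ≠ u') : Pair := ⟨{u, u'}, Finset.card_pair h⟩

/-- A separator assigns a natural number to each two-element subset. -/
abbrev Separator := Pair → ℕ

/-- Distance of natural numbers. -/
def dist (a b : ℕ) : ℕ := ((a : ℤ) - (b : ℤ)).natAbs

/-- `δ` is a separator for `⟨A, B⟩`. Here `cmp a b` is the order type (`<`, `=` or `>`)
of the pair `(a, b)`. -/
def IsSeparator (A B : Set Interp) (δ : Separator) : Prop :=
  ∀ I ∈ A, ∀ J ∈ B, ∃ (u u' : Tm) (h : u ≠ u'),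
    cmp (I.val u) (I.val u') ≠ cmp (J.val u) (J.val u') ∨
      (min (dist (I.val u) (I.val u')) (dist (J.val u) (J.val u')) ≤ δ (mkPair u u' h) ∧
        dist (I.val u) (I.val u') ≠ dist (J.val u) (J.val u'))

theorem Var.min_ne (u : Var) : Tm.min ≠ u.toTm := by
  cases u <;> decide

theorem Var.ne_max (u : Var) : u.toTm ≠ Tm.max := by
  cases u <;> decide

/-- The border-distance: the maximum of `δ {min, max}` and of all
`δ {min, u} + δ {u', max}` with variables `u`, `u'`, possibly equal. -/
def borderDist (δ : Separator) : ℕ :=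
  max (δ (mkPair .min .max (by decide)))
    (Finset.univ.sup fun q : Var × Var =>
      δ (mkPair .min q.1.toTm q.1.min_ne) + δ (mkPair q.2.toTm .max q.2.ne_max))

/-- The centre-distance: the maximum of `δ p + δ q` over different
two-element subsets `p`, `q` of `{x, y, z}`. -/
def centreDist (δ : Separator) : ℕ :=
  (Finset.univ.filter fun r : Pair × Pair =>
    r.1.1 ⊆ {Tm.x, Tm.y, Tm.z} ∧ r.2.1 ⊆ {Tm.x, Tm.y, Tm.z} ∧ r.1 ≠ r.2).sup
      fun r => δ r.1 + δ r.2

/-- The weight of a separator. -/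
noncomputable def weight (δ : Separator) : ℝ :=
  Real.sqrt ((centreDist δ : ℝ) ^ 2 + (borderDist δ : ℝ))

/-- A minimal separator for `⟨A, B⟩`: a separator for `⟨A, B⟩` of minimal weight. -/
def IsMinimalSeparator (A B : Set Interp) (δ : Separator) : Prop :=
  IsSeparator A B δ ∧ ∀ δ' : Separator, IsSeparator A B δ' → weight δ ≤ weight δ'

end OrderLogic

/-! Every formula `ψ` of counting rank at most `t` is assigned a state: a record of how precisely
`ψ` sees the differences between variables and the distances to the borders. Interpretations related
by the state agree on `ψ`, so the thresholds of the state form a separator for `⟨A, B⟩`. It remains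
to keep its weight at most `t * ψ.size`; minimality of `δ` does the rest.

The transfer lemma `exists_witnesses` carries the quantifier case. It matches `k` witnesses in one
order by `k` witnesses in another, provided the gaps between reference points agree up to the sum of
their two thresholds plus `k` plus the number of isolated points.

The accounting is in `State.Bounded`: an integer `N` with `c ^ 2 + β ≤ N ^ 2`, plus one unit of
credit for each pair of variables with a nontrivial description (a link). Credit is needed because a
successor atom should not yet count towards the centre: it isolates one difference `p`, charged `|p|
- 1`. A link is spent when two descriptions of the same pair merge, when a quantifier removes it, or
at the end, when isolated points become thresholds. A quantifier that removes a link raises `N` by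
one more than `c`, and the resulting gain in `N ^ 2 - c ^ 2` pays for the growth of the border
thresholds by about `2 * c` (`Bounded.quant`). Conjunction and disjunction add the bounds
(`Bounded.merge`); negation is free because the relation of a state is symmetric. -/

namespace OrderLogic

/-! ### Descriptions of a single difference. -/

/-- Agreement of two integers up to a threshold: they are equal, or both exceed `δ`, or both
are below `-δ`. -/
def ThrRel (δ d d' : ℤ) : Prop := d = d' ∨ (δ < d ∧ δ < d') ∨ (d < -δ ∧ d' < -δ)

/-- What a formula sees of the difference of two positions: nothing, the exact value up to a
threshold, or only whether it is equal to `p`. -/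
inductive Desc
  | free
  | thr (δ : ℕ)
  | pt (p : ℤ)

namespace Desc

/-- Two differences that cannot be told apart. -/
def Rel : Desc → ℤ → ℤ → Prop
  | free, _, _ => True
  | thr δ, d, d' => ThrRel δ d d'
  | pt p, d, d' => d = p ↔ d' = p

/-- The least threshold that refines the description. -/
def val : Desc → ℕ
  | free => 0
  | thr δ => δ
  | pt p => p.natAbs

/-- The contribution to the centre-distance; an isolated point counts one less. -/
def eff : Desc → ℕ
  | free => 0
  | thr δ => δ
  | pt p => p.natAbs - 1

/-- `1` unless the description is trivial. -/
def ne : Desc → ℕ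
  | free => 0
  | thr _ => 1
  | pt _ => 1

/-- `1` for an isolated point. -/
def mark : Desc → ℕ
  | free => 0
  | thr _ => 0
  | pt _ => 1

/-- The description of the negated difference. -/
def flip : Desc → Desc
  | free => free
  | thr δ => thr δ
  | pt p => pt (-p)

/-- A description that refines both given ones. -/
def merge : Desc → Desc → Desc
  | free, d => d
  | thr δ, free => thr δ
  | pt p, free => pt p
  | thr δ, thr δ' => thr (max δ δ')
  | thr δ, pt q => thr (max δ q.natAbs)
  | pt p, thr δ => thr (max p.natAbs δ)
  | pt p, pt q => thr (max p.natAbs q.natAbs)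

/-- What is seen of `w - v` when a value `a` is quantified that is described by `d` relative to `v`
and by `d'` relative to `w`. -/
def comb (k : ℕ) : Desc → Desc → Desc
  | free, _ => free
  | thr _, free => free
  | pt _, free => free
  | thr δ, thr δ' => thr (δ + δ' + k)
  | thr δ, pt q => thr (δ + (q.natAbs - 1) + k)
  | pt p, thr δ => thr ((p.natAbs - 1) + δ + k)
  | pt p, pt q => if p = q then thr 0 else pt (p - q)

theorem rel_symm {d : Desc} {a b : ℤ} (h : d.Rel a b) : d.Rel b a := by
  cases d <;> simp only [Rel, ThrRel] at * <;> grind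

theorem rel_neg_of_flip {d : Desc} {a b a' b' : ℤ} (h : d.flip.Rel a b) (ha : a' = -a)
    (hb : b' = -b) : d.Rel a' b' := by
  subst ha hb
  cases d <;> simp only [Rel, ThrRel, flip] at * <;> omega

theorem rel_of_thr {d : Desc} {δ : ℕ} (hδ : d.val ≤ δ) {a b : ℤ} (h : ThrRel δ a b) :
    d.Rel a b := by
  cases d <;> simp only [Rel, ThrRel, val] at * <;> omega

theorem rel_left_of_merge {d d' : Desc} {a b : ℤ} (h : (merge d d').Rel a b) : d.Rel a b := by
  cases d <;> cases d' <;> simp only [merge] at h <;>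
    first
    | exact h
    | exact trivial
    | exact rel_of_thr (le_max_left _ _) h

theorem rel_right_of_merge {d d' : Desc} {a b : ℤ} (h : (merge d d').Rel a b) : d'.Rel a b := by
  cases d <;> cases d' <;> simp only [merge] at h <;>
    first
    | exact h
    | exact trivial
    | exact rel_of_thr (le_max_right _ _) h

/-- The credit `ne` covers exactly the unit by which `eff` undercounts an isolated point. -/
theorem val_le (d : Desc) : d.val ≤ d.eff + d.ne := by
  cases d <;> simp only [eff, val, ne] <;> omega

theorem ne_le_one (d : Desc) : d.ne ≤ 1 := by
  cases d <;> simp [ne]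

theorem eff_flip (d : Desc) : d.flip.eff = d.eff := by
  cases d <;> simp [eff, flip]

theorem ne_flip (d : Desc) : d.flip.ne = d.ne := by
  cases d <;> simp [ne, flip]

theorem flip_ne_pt_zero {d : Desc} (h : d ≠ pt 0) : d.flip ≠ pt 0 := by
  cases d <;> simp_all [flip]

theorem merge_ne_pt_zero {d d' : Desc} (h : d ≠ pt 0) (h' : d' ≠ pt 0) : merge d d' ≠ pt 0 := by
  cases d <;> cases d' <;> simp_all [merge]

theorem comb_ne_pt_zero (k : ℕ) (d d' : Desc) : comb k d d' ≠ pt 0 := by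
  cases d <;> cases d' <;> simp only [comb] <;> try simp
  split_ifs with h
  · simp
  · simpa [sub_eq_zero] using h

/-- The overlap of two descriptions. -/
theorem ne_merge (d d' : Desc) : (merge d d').ne + d.ne * d'.ne = d.ne + d'.ne := by
  cases d <;> cases d' <;> simp [merge, ne]

/-- Merging can turn an isolated point, charged `|p| - 1`, into a threshold `|p|`. This costs at
most one, and only when both descriptions are nontrivial, which is when `ne_merge` releases a link.
-/
theorem eff_merge_le (d d' : Desc) :
    (merge d d').eff ≤ d.eff + d.ne * d'.ne ∨ (merge d d').eff ≤ d'.eff + d.ne * d'.ne := by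
  cases d <;> cases d' <;> simp only [merge, ne, eff] <;> omega

end Desc

/-! ### Transfer of witnesses between two configurations of integers. -/

open Desc in
/-- Transfer of `k` values: relative to positions `P` and `P'` that agree up to suitable
thresholds, every set of `k` integers is matched by a set of `k` integers of the same kinds. -/
theorem exists_witnesses {ι : Type} [Fintype ι] (A : ι → Desc) (P P' : ι → ℤ) (k μ : ℕ)
    (Mk : Finset ℤ) (hMk : ∀ i p, A i = pt p → P' i + p ∈ Mk) (hμ : Mk.card ≤ μ)
    (H1 : ∀ i j a b, A i = thr a → A j = thr b →
      ThrRel (a + b + (k + μ : ℕ)) (P j - P i) (P' j - P' i))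
    (H2 : ∀ i j a p, A i = thr a → A j = pt p → ThrRel a (P j + p - P i) (P' j + p - P' i))
    (H3 : ∀ i j p q, A i = pt p → A j = pt q → (P i + p = P j + q ↔ P' i + p = P' j + q))
    (H4 : ∀ i j l a b p, A i = thr a → A j = thr b → A l = pt p →
      P j - P i = P' j - P' i → P j - P i ≤ a + b + (k + μ : ℕ) →
      a < P l + p - P i → b < P j - (P l + p) → a < P' l + p - P' i → b < P' j - (P' l + p) →
      P l - P i = P' l - P' i)
    (S : Finset ℤ) (hS : S.card = k)
    (hlo : ∀ z ∈ S, ∃ i a, A i = thr a ∧ P i ≤ z) (hhi : ∀ z ∈ S, ∃ i a, A i = thr a ∧ z ≤ P i) :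
    ∃ S' : Finset ℤ, S'.card = k ∧ ∀ b ∈ S', ∃ a ∈ S, ∀ i, (A i).Rel (a - P i) (b - P' i) := by
  classical
  rcases S.eq_empty_or_nonempty with rfl | ⟨z₀, hz₀⟩
  · exact ⟨∅, hS, by simp⟩
  obtain ⟨i₀, -⟩ := hlo z₀ hz₀
  -- If one element of `S` already has `k` lookalikes, these alone form `S'`. Otherwise every
  -- element is matched by a translate, and the matching must be injective.
  by_cases hbig : ∃ a ∈ S, ∃ C : Finset ℤ, k ≤ C.card ∧ ∀ b ∈ C, ∀ i, (A i).Rel (a - P i) (b - P' i)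
  · obtain ⟨a, ha, C, hC, h⟩ := hbig
    obtain ⟨C', hC', hc⟩ := Finset.exists_subset_card_eq hC
    exact ⟨C', hc, fun b hb => ⟨a, ha, h b (hC' hb)⟩⟩
  let below : ℤ → Finset ι := fun a => Finset.univ.filter fun i => ∃ δ, A i = thr δ ∧ P i < a
  have hl : ∀ B : Finset ι, ∃ l, B.Nonempty → l ∈ B ∧
      ∀ i ∈ B, P' i + (A i).val ≤ P' l + (A l).val := by
    intro B
    by_cases hB : B.Nonempty
    · obtain ⟨l, hl, h⟩ := B.exists_max_image (fun i => P' i + ((A i).val : ℤ)) hB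
      exact ⟨l, fun _ => ⟨hl, h⟩⟩
    · exact ⟨i₀, fun h => absurd h hB⟩
  choose l hl using hl
  -- A far element is no isolated point and lies beyond the threshold of every anchor. Its
  -- translation is determined by `below a` alone, so far elements with the same anchors below them
  -- are shifted equally; this gives injectivity.
  let far : ℤ → Prop := fun a => (∀ i p, A i = pt p → a ≠ P i + p) ∧
    ∀ i δ, A i = thr δ → δ < a - P i ∨ a - P i < -δ
  have key : ∀ a ∈ S, ∃ b, (∀ i, (A i).Rel (a - P i) (b - P' i)) ∧
      (far a → b = a + (P' (l (below a)) - P (l (below a)))) := by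
    intro a ha
    by_cases hm : ∃ i p, A i = pt p ∧ a = P i + p
    · obtain ⟨i, p, hi, rfl⟩ := hm
      refine ⟨P' i + p, fun j => ?_, fun h => absurd rfl (h.1 i p hi)⟩
      cases hj : A j with
      | free => trivial
      | thr δ => exact H2 j i δ p hj hi
      | pt q =>
        have := H3 i j p q hi hj
        simp only [Desc.Rel]
        omega
    by_cases hn : ∃ i δ, A i = thr δ ∧ -(δ : ℤ) ≤ a - P i ∧ a - P i ≤ δ
    · obtain ⟨i, δ, hi, h1, h2⟩ := hn
      refine ⟨a + (P' i - P i), fun j => ?_, fun h => ?_⟩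
      · cases hj : A j with
        | free => trivial
        | thr δ' =>
          have := H1 i j δ δ' hi hj
          simp only [Desc.Rel, ThrRel] at this ⊢
          omega
        | pt q =>
          have := H2 i j δ q hi hj
          simp only [Desc.Rel, ThrRel] at this ⊢
          omega
      · have := h.2 i δ hi
        omega
    push Not at hm hn
    have hfar : ∀ i δ, A i = thr δ → δ < a - P i ∨ a - P i < -δ := fun i δ hi => by
      have := hn i δ hi
      omega
    have hbn : (below a).Nonempty := by
      obtain ⟨i, δ, hi, h⟩ := hlo a ha
      refine ⟨i, Finset.mem_filter.2 ⟨Finset.mem_univ _, δ, hi, ?_⟩⟩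
      have := hfar i δ hi
      omega
    obtain ⟨hlm, hlmax⟩ := hl (below a) hbn
    generalize hll : l (below a) = l0 at *
    obtain ⟨-, δl, hAl, hPl⟩ := Finset.mem_filter.1 hlm
    let above : Finset ι := Finset.univ.filter fun i => ∃ δ, A i = thr δ ∧ a < P i
    have han : above.Nonempty := by
      obtain ⟨i, δ, hi, h⟩ := hhi a ha
      refine ⟨i, Finset.mem_filter.2 ⟨Finset.mem_univ _, δ, hi, ?_⟩⟩
      have := hfar i δ hi
      omega
    obtain ⟨r, hrm, hrmin⟩ := above.exists_min_image (fun i => P' i - ((A i).val : ℤ)) han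
    obtain ⟨-, δr, hAr, hPr⟩ := Finset.mem_filter.1 hrm
    have hfl := hfar l0 δl hAl
    have hfr := hfar r δr hAr
    -- The anchors `l0` and `r` give the tightest bounds on the primed side, so lying between them
    -- beyond both thresholds settles all threshold descriptions at once.
    have hcell : ∀ b, P' l0 + δl < b → b < P' r - δr → (∀ i p, A i = pt p → b ≠ P' i + p) →
        ∀ i, (A i).Rel (a - P i) (b - P' i) := by
      intro b hb1 hb2 hb3 i
      cases hi : A i with
      | free => trivial
      | thr δ =>
        have hf := hfar i δ hi
        rcases lt_or_ge (P i) a with h | h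
        · have := hlmax i (Finset.mem_filter.2 ⟨Finset.mem_univ _, δ, hi, h⟩)
          simp only [hi, hAl, val] at this
          simp only [Desc.Rel, ThrRel]
          omega
        · have := hrmin i (Finset.mem_filter.2 ⟨Finset.mem_univ _, δ, hi, by omega⟩)
          simp only [hi, hAr, val] at this
          simp only [Desc.Rel, ThrRel]
          omega
      | pt p =>
        have h1 := hm i p hi
        have h2 := hb3 i p hi
        simp only [Desc.Rel]
        omega
    have h1 := H1 l0 r δl δr hAl hAr
    simp only [ThrRel] at h1
    -- A longer gap would leave at least `k + μ` integers in the cell; discarding the at most `μ`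
    -- isolated positions keeps `k` lookalikes of `a`, contrary to `hbig`. Hence the gap has the
    -- same length on both sides.
    have hsmall : ¬ ((δl : ℤ) + δr + (k + μ : ℕ) < P' r - P' l0) := by
      intro hlt
      refine hbig ⟨a, ha, Finset.Ioo (P' l0 + δl) (P' r - δr) \ Mk, ?_, ?_⟩
      · have := Finset.le_card_sdiff Mk (Finset.Ioo (P' l0 + δl) (P' r - δr))
        rw [Int.card_Ioo] at this
        omega
      · intro b hb
        simp only [Finset.mem_sdiff, Finset.mem_Ioo] at hb
        exact hcell b hb.1.1 hb.1.2 fun i p hi h => hb.2 (h ▸ hMk i p hi)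
    have hg : P r - P l0 = P' r - P' l0 := by omega
    refine ⟨a + (P' l0 - P l0), hcell _ (by omega) (by omega) ?_, fun _ => rfl⟩
    intro i p hi h
    have e1 := H2 l0 i δl p hAl hi
    have e2 := H2 r i δr p hAr hi
    have e3 := hm i p hi
    simp only [ThrRel] at e1 e2
    have := H4 l0 r i δl δr p hAl hAr hi hg (by omega) (by omega) (by omega) (by omega) (by omega)
    omega
  choose! f hf hf' using key
  -- Equal images put `a` and `a'` in the same cell, or at the same exact offset from some anchor.
  have hinj : Set.InjOn f S := by
    intro a ha a' ha' h
    have ea := hf a ha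
    have ea' := hf a' ha'
    rw [← h] at ea'
    by_cases hfa : far a
    · have hfa' : far a' := by
        refine ⟨fun i p hi hh => hfa.1 i p hi ?_, fun i δ hi => ?_⟩
        · have e1 := ea i
          have e2 := ea' i
          simp only [hi, Desc.Rel] at e1 e2
          omega
        · have e1 := ea i
          have e2 := ea' i
          have e3 := hfa.2 i δ hi
          simp only [hi, Desc.Rel, ThrRel] at e1 e2
          omega
      have hb : below a = below a' := by
        ext i
        simp only [below, Finset.mem_filter, Finset.mem_univ, true_and]
        refine exists_congr fun δ => and_congr_right fun hi => ?_
        have e1 := ea i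
        have e2 := ea' i
        have e3 := hfa.2 i δ hi
        have e4 := hfa'.2 i δ hi
        simp only [hi, Desc.Rel, ThrRel] at e1 e2
        omega
      have e1 := hf' a ha hfa
      have e2 := hf' a' ha' hfa'
      rw [hb] at e1
      omega
    · by_cases hm : ∀ i p, A i = pt p → a ≠ P i + p
      · have : ∃ i δ, A i = thr δ ∧ ¬ ((δ : ℤ) < a - P i ∨ a - P i < -δ) := by
          by_contra! hc
          exact hfa ⟨hm, fun i δ hi => by have := hc i δ hi; omega⟩
        obtain ⟨i, δ, hi, hh⟩ := this
        have e1 := ea i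
        have e2 := ea' i
        simp only [hi, Desc.Rel, ThrRel] at e1 e2
        omega
      · push Not at hm
        obtain ⟨i, p, hi, hh⟩ := hm
        have e1 := ea i
        have e2 := ea' i
        simp only [hi, Desc.Rel] at e1 e2
        omega
  refine ⟨S.image f, by rw [Finset.card_image_of_injOn hinj, hS], fun b hb => ?_⟩
  obtain ⟨a, ha, rfl⟩ := Finset.mem_image.1 hb
  exact ⟨a, ha, hf a ha⟩

/-! ### Transfer inside an interval with two fixed variables. -/

namespace Desc

/-- The isolated positions seen from position `x`. -/
def marks : Desc → ℤ → Finset ℤ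
  | pt p, x => {x + p}
  | _, _ => ∅

theorem card_marks (d : Desc) (x : ℤ) : (d.marks x).card ≤ d.mark := by
  cases d <;> simp [marks, mark]

/-- The threshold needed between a border with threshold `m - 1` and a variable, when a value that
is described by a `Desc` relative to the variable is quantified. -/
def reach (m k μ : ℕ) : Desc → ℕ
  | free => 0
  | thr δ => m + δ + k + μ
  | pt p => m + (p.natAbs - 1) + k

end Desc

/-- The borders and the two variables that are not quantified. -/
inductive Anchor
  | lo | hi | fst | snd
  deriving DecidableEq

instance : Fintype Anchor := ⟨{.lo, .hi, .fst, .snd}, fun i => by cases i <;> decide⟩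

/-- A function on the anchors given by its values. -/
def Anchor.elim {α : Type} (a b c d : α) : Anchor → α
  | .lo => a
  | .hi => b
  | .fst => c
  | .snd => d

-- The borders serve as two more threshold anchors. If border distances are seen (`ε = 0`), they
-- stand at the ends of the interval. If not (`ε = 1`), they stand one step outside with threshold
-- `0`, which only forces witnesses to stay in the interval and saves one unit at each border.
set_option maxHeartbeats 1000000 in
open Desc in
theorem exists_witnesses_interval (d e : Desc) (hd : d ≠ pt 0) (he : e ≠ pt 0)
    (n n' v v' w w' : ℤ) (m M ε k μ : ℕ) (hμ : d.mark + e.mark = μ)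
    (hε : ε = 0 ∨ ε = 1 ∧ m = 0 ∧ M = 0)
    (hv : 0 ≤ v ∧ v ≤ n) (hv' : 0 ≤ v' ∧ v' ≤ n') (hw : 0 ≤ w ∧ w ≤ n) (hw' : 0 ≤ w' ∧ w' ≤ n')
    (hvw : (comb (k + 1) d e).Rel (w - v) (w' - v'))
    (hlv : ThrRel (d.reach (m + 1 - ε) k μ) v v') (hlw : ThrRel (e.reach (m + 1 - ε) k μ) w w')
    (hhv : ThrRel (d.reach (M + 1 - ε) k μ) (n - v) (n' - v'))
    (hhw : ThrRel (e.reach (M + 1 - ε) k μ) (n - w) (n' - w'))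
    (hlh : ThrRel ((m + 1 - ε) + (M + 1 - ε) + k + μ : ℕ) n n')
    (S : Finset ℤ) (hS : S.card = k + 1) (hSn : ∀ a ∈ S, 0 ≤ a ∧ a ≤ n) :
    ∃ S' : Finset ℤ, S'.card = k + 1 ∧ ∀ b ∈ S', (0 ≤ b ∧ b ≤ n') ∧ ∃ a ∈ S,
      ThrRel m (a + ε) (b + ε) ∧ ThrRel M (n + ε - a) (n' + ε - b) ∧
        d.Rel (a - v) (b - v') ∧ e.Rel (a - w) (b - w') := by
  let A : Anchor → Desc := Anchor.elim (thr m) (thr M) d e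
  let P : Anchor → ℤ := Anchor.elim (-ε) (n + ε) v w
  let P' : Anchor → ℤ := Anchor.elim (-ε) (n' + ε) v' w'
  have main := exists_witnesses A P P' (k + 1) μ (d.marks v' ∪ e.marks w') ?_ ?_ ?_ ?_ ?_ ?_ S hS
    ?_ ?_
  · obtain ⟨S', hS', h⟩ := main
    refine ⟨S', hS', fun b hb => ?_⟩
    obtain ⟨a, ha, hr⟩ := h b hb
    have h1 := hr .lo
    have h2 := hr .hi
    have h3 := hSn a ha
    simp only [A, Anchor.elim, P, P', Desc.Rel, ThrRel] at h1 h2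
    refine ⟨by omega, a, ha, ?_, ?_, hr .fst, hr .snd⟩ <;> simp only [ThrRel] <;> omega
  · intro i p h
    cases i <;> simp_all [A, Anchor.elim, P', marks]
  · exact (Finset.card_union_le _ _).trans (hμ ▸ add_le_add (card_marks _ _) (card_marks _ _))
  · subst hμ
    intro i j a b hi hj
    cases d <;> cases e <;> cases i <;> cases j <;>
      simp only [A, Anchor.elim, reduceCtorEq, thr.injEq] at hi hj <;>
      subst_vars <;>
      simp only [P, P', Anchor.elim, ThrRel, Desc.Rel, comb, reach, mark] at * <;> first
      | exact Or.inl trivial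
      | ((try clear hlv); (try clear hlw); (try clear hhv); (try clear hhw); (try clear hlh); omega)
      | ((try clear hvw); (try clear hlw); (try clear hhv); (try clear hhw); (try clear hlh); omega)
      | ((try clear hvw); (try clear hlv); (try clear hhv); (try clear hhw); (try clear hlh); omega)
      | ((try clear hvw); (try clear hlv); (try clear hlw); (try clear hhw); (try clear hlh); omega)
      | ((try clear hvw); (try clear hlv); (try clear hlw); (try clear hhv); (try clear hlh); omega)
      | ((try clear hvw); (try clear hlv); (try clear hlw); (try clear hhv); (try clear hhw); omega)
  · subst hμ
    intro i j a p hi hj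
    cases d <;> cases e <;> cases i <;> cases j <;>
      simp only [A, Anchor.elim, reduceCtorEq, thr.injEq, pt.injEq, ne_eq] at hi hj hd he <;>
      subst_vars <;>
      simp only [P, P', Anchor.elim, ThrRel, Desc.Rel, comb, reach, mark] at * <;> first
      | ((try clear hlv); (try clear hlw); (try clear hhv); (try clear hhw); (try clear hlh); omega)
      | ((try clear hvw); (try clear hlw); (try clear hhv); (try clear hhw); (try clear hlh); omega)
      | ((try clear hvw); (try clear hlv); (try clear hhv); (try clear hhw); (try clear hlh); omega)
      | ((try clear hvw); (try clear hlv); (try clear hlw); (try clear hhw); (try clear hlh); omega)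
      | ((try clear hvw); (try clear hlv); (try clear hlw); (try clear hhv); (try clear hlh); omega)
  · intro i j p q hi hj
    cases d <;> cases e <;> cases i <;> cases j <;>
      simp only [A, Anchor.elim, reduceCtorEq, pt.injEq] at hi hj <;>
      subst_vars <;>
      simp only [P, P', Anchor.elim, comb] at * <;> first | omega | (split_ifs at hvw <;>
        simp only [Desc.Rel, ThrRel] at hvw <;> omega)
  · subst hμ
    intro i j l a b p hi hj hl
    cases d <;> cases e <;> cases i <;> cases j <;> cases l <;>
      simp only [A, Anchor.elim, reduceCtorEq, thr.injEq, pt.injEq, ne_eq] at hi hj hl hd he <;>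
      subst_vars <;>
      simp only [P, P', Anchor.elim, ThrRel, Desc.Rel, comb, reach, mark] at * <;> intros <;> first
      | ((try clear hlw); (try clear hhv); (try clear hhw); (try clear hlh); omega)
      | ((try clear hlv); (try clear hlw); (try clear hhw); (try clear hlh); omega)
      | ((try clear hlv); (try clear hhv); (try clear hhw); (try clear hlh); omega)
      | ((try clear hlv); (try clear hlw); (try clear hhv); (try clear hlh); omega)
      | ((try clear hvw); (try clear hlw); (try clear hhw); (try clear hlh); omega)
      | ((try clear hvw); (try clear hlv); (try clear hhv); (try clear hlh); omega)
  · exact fun z hz => ⟨.lo, m, rfl, by have := hSn z hz; simp only [P, Anchor.elim]; omega⟩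
  · exact fun z hz => ⟨.hi, M, rfl, by have := hSn z hz; simp only [P, Anchor.elim]; omega⟩

/-! ### States and their bounds. -/

/-- The cyclic successor of a variable. -/
def Var.next : Var → Var
  | .x => .y
  | .y => .z
  | .z => .x

/-- The position of a variable. -/
def Interp.pos (I : Interp) (v : Var) : ℤ := ((I.α v : ℕ) : ℤ)

/-- Change the value of a variable. -/
def Interp.upd (I : Interp) (u : Var) (a : Fin (I.n + 1)) : Interp := ⟨I.n, Function.update I.α u a⟩

/-- What a formula sees of an interpretation. `D i` describes the difference of the two variables
other than `i`; the thresholds `mn`, `mx`, `mm` for the distances from `min` to a variable, from a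
variable to `max` and from `min` to `max` are only used if `o` holds. -/
structure State where
  D : Var → Desc
  o : Bool
  mn : Var → ℕ
  mx : Var → ℕ
  mm : ℕ

namespace State

/-- Two interpretations that cannot be told apart. -/
def Rel (s : State) (I J : Interp) : Prop :=
  (∀ i, (s.D i).Rel (I.pos i.next.next - I.pos i.next) (J.pos i.next.next - J.pos i.next)) ∧
    (s.o = true → (∀ v, ThrRel (s.mn v) (I.pos v) (J.pos v)) ∧
      (∀ v, ThrRel (s.mx v) (I.n - I.pos v) (J.n - J.pos v)) ∧ ThrRel s.mm I.n J.n)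

/-- The number of pairs of variables with a nontrivial description. -/
def links (s : State) : ℕ := (s.D .x).ne + (s.D .y).ne + (s.D .z).ne

/-- The invariant that bounds the weight of a state by `M`. -/
def Bounded (s : State) (M : ℕ) : Prop :=
  ∃ c β N : ℕ, (∀ i j, i ≠ j → (s.D i).eff + (s.D j).eff ≤ c) ∧ (∀ v w, s.mn v + s.mx w ≤ β) ∧
    s.mm ≤ β ∧ (s.o = true → 1 ≤ β) ∧ c ^ 2 + β ≤ N ^ 2 ∧ N + s.links ≤ M

/-- The state after quantification of `u` with multiplicity `k + 1`. -/
def quant (s : State) (k : ℕ) (u : Var) : State :=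
  let v := u.next
  let w := v.next
  let d := (s.D w).flip
  let e := s.D v
  let m := if s.o then s.mn u + 1 else 0
  let M := if s.o then s.mx u + 1 else 0
  let μ := d.mark + e.mark
  { D := fun i => if i = u then (s.D u).merge (Desc.comb (k + 1) d e) else .free
    o := true
    mn := fun i => if i = v then max (s.mn v) (d.reach m k μ)
      else if i = w then max (s.mn w) (e.reach m k μ) else 0
    mx := fun i => if i = v then max (s.mx v) (d.reach M k μ)
      else if i = w then max (s.mx w) (e.reach M k μ) else 0
    mm := max s.mm (m + M + k + μ) }

/-- A state that refines both given ones. -/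
def merge (s s' : State) : State where
  D := fun i => (s.D i).merge (s'.D i)
  o := s.o || s'.o
  mn := fun v => max (s.mn v) (s'.mn v)
  mx := fun v => max (s.mx v) (s'.mx v)
  mm := max s.mm s'.mm

end State

theorem ThrRel.mono {a b d d' : ℤ} (hab : a ≤ b) (h : ThrRel b d d') : ThrRel a d d' := by
  simp only [ThrRel] at *
  omega

theorem ThrRel.symm {a d d' : ℤ} (h : ThrRel a d d') : ThrRel a d' d := by
  simp only [ThrRel] at *
  omega

namespace State

theorem Rel.symm {s : State} {I J : Interp} (h : s.Rel I J) : s.Rel J I :=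
  ⟨fun i => Desc.rel_symm (h.1 i), fun ho =>
    ⟨fun v => ((h.2 ho).1 v).symm, fun v => ((h.2 ho).2.1 v).symm, (h.2 ho).2.2.symm⟩⟩

theorem Rel.left {s s' : State} {I J : Interp} (h : (s.merge s').Rel I J) : s.Rel I J := by
  refine ⟨fun i => Desc.rel_left_of_merge (h.1 i), fun ho => ?_⟩
  obtain ⟨h1, h2, h3⟩ := h.2 (by simp [merge, ho])
  exact ⟨fun v => (h1 v).mono (by simp [merge]), fun v => (h2 v).mono (by simp [merge]),
    h3.mono (by simp [merge])⟩

theorem Rel.right {s s' : State} {I J : Interp} (h : (s.merge s').Rel I J) : s'.Rel I J := by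
  refine ⟨fun i => Desc.rel_right_of_merge (h.1 i), fun ho => ?_⟩
  obtain ⟨h1, h2, h3⟩ := h.2 (by simp [merge, ho])
  exact ⟨fun v => (h1 v).mono (by simp [merge]), fun v => (h2 v).mono (by simp [merge]),
    h3.mono (by simp [merge])⟩

theorem Bounded.mono {s : State} {M M' : ℕ} (h : s.Bounded M) (hM : M ≤ M') : s.Bounded M' := by
  obtain ⟨c, β, N, h1, h2, h3, h4, h5, h6⟩ := h
  exact ⟨c, β, N, h1, h2, h3, h4, h5, h6.trans hM⟩

/-- With `r` the number of pairs described by both states, merging loses `r` links and raises the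
centre by at most `r`, so `N + N' + r` leaves the total unchanged. The square inequality survives
because `c ≤ N` and `c' ≤ N'`. -/
theorem Bounded.merge {s s' : State} {M M' : ℕ} (h : s.Bounded M) (h' : s'.Bounded M') :
    (s.merge s').Bounded (M + M') := by
  obtain ⟨c, β, N, h1, h2, h3, h4, h5, h6⟩ := h
  obtain ⟨c', β', N', h1', h2', h3', h4', h5', h6'⟩ := h'
  obtain ⟨r, hr⟩ : ∃ r, r = (s.D .x).ne * (s'.D .x).ne + (s.D .y).ne * (s'.D .y).ne +
    (s.D .z).ne * (s'.D .z).ne := ⟨_, rfl⟩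
  refine ⟨c + c' + r, β + β', N + N' + r, ?_, ?_, ?_, ?_, ?_, ?_⟩
  · intro i j hij
    have e1 := h1 i j hij
    have e2 := h1' i j hij
    have e3 := Desc.eff_merge_le (s.D i) (s'.D i)
    have e4 := Desc.eff_merge_le (s.D j) (s'.D j)
    have e5 : (s.D i).ne * (s'.D i).ne + (s.D j).ne * (s'.D j).ne ≤ r := by
      subst hr
      cases i <;> cases j <;> first | exact absurd rfl hij | omega
    simp only [State.merge]
    omega
  · intro v w
    have e1 := h2 v w
    have e2 := h2' v w
    simp only [State.merge]
    omega
  · simp only [State.merge]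
    omega
  · simp only [State.merge, Bool.or_eq_true]
    rintro (ho | ho)
    · exact (h4 ho).trans (Nat.le_add_right _ _)
    · exact (h4' ho).trans (Nat.le_add_left _ _)
  · have hc : c ≤ N := by nlinarith
    have hc' : c' ≤ N' := by nlinarith
    nlinarith [Nat.mul_le_mul hc hc', Nat.mul_le_mul_left r (Nat.add_le_add hc hc')]
  · have e1 := Desc.ne_merge (s.D .x) (s'.D .x)
    have e2 := Desc.ne_merge (s.D .y) (s'.D .y)
    have e3 := Desc.ne_merge (s.D .z) (s'.D .z)
    simp only [links, State.merge] at *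
    omega

end State

/-! ### Soundness of quantification. -/

theorem Var.ne_next (u : Var) : u.next ≠ u := by cases u <;> decide
theorem Var.ne_next_next (u : Var) : u.next.next ≠ u := by cases u <;> decide
theorem Var.next_next_next (u : Var) : u.next.next.next = u := by cases u <;> rfl

theorem Var.forall_iff (u : Var) {p : Var → Prop} : (∀ i, p i) ↔ p u ∧ p u.next ∧ p u.next.next := by
  refine ⟨fun h => ⟨h _, h _, h _⟩, fun ⟨h1, h2, h3⟩ i => ?_⟩
  cases u <;> cases i <;> assumption

namespace State

theorem links_eq (s : State) (u : Var) :
    s.links = (s.D u).ne + (s.D u.next).ne + (s.D u.next.next).ne := by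
  cases u <;> simp only [links, Var.next] <;> omega

/-- One step of a counting game: the new state supplies the gap conditions of
`exists_witnesses_interval`, and everything not involving `u` is inherited through the maxima and
the merge in `quant`. -/
theorem exists_rel_of_quant (s : State) (hs : ∀ i, s.D i ≠ .pt 0) (k : ℕ) (u : Var)
    {I J : Interp} (h : (s.quant k u).Rel I J) (S : Finset (Fin (I.n + 1))) (hS : S.card = k + 1) :
    ∃ S' : Finset (Fin (J.n + 1)), S'.card = k + 1 ∧
      ∀ b ∈ S', ∃ a ∈ S, s.Rel (I.upd u a) (J.upd u b) := by
  classical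
  obtain ⟨hD, ho⟩ := h
  obtain ⟨hmn, hmx, hmm⟩ := ho rfl
  have hpos : ∀ (K : Interp) v, 0 ≤ K.pos v ∧ K.pos v ≤ K.n := fun K v => by
    have := (K.α v).is_lt
    simp only [Interp.pos]
    omega
  have h1 := hD u
  have h2 := hmn u.next
  have h3 := hmn u.next.next
  have h4 := hmx u.next
  have h5 := hmx u.next.next
  simp only [quant, if_true, Var.ne_next u.next, if_false] at h1 h2 h3 h4 h5 hmm
  have key := exists_witnesses_interval (s.D u.next.next).flip (s.D u.next)
    (Desc.flip_ne_pt_zero (hs _)) (hs _) I.n J.n (I.pos u.next) (J.pos u.next)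
    (I.pos u.next.next) (J.pos u.next.next) (if s.o then s.mn u else 0) (if s.o then s.mx u else 0)
    (if s.o then 0 else 1) k _ rfl (by split_ifs <;> simp)
    (hpos _ _) (hpos _ _) (hpos _ _) (hpos _ _) (Desc.rel_right_of_merge h1)
    (h2.mono (by split_ifs <;> simp)) (h3.mono (by split_ifs <;> simp))
    (h4.mono (by split_ifs <;> simp)) (h5.mono (by split_ifs <;> simp))
    (hmm.mono (by split_ifs <;> simp))
    (S.image fun a : Fin (I.n + 1) => ((a : ℕ) : ℤ))
    (by rw [Finset.card_image_of_injective _ fun a b hab => Fin.ext (by exact_mod_cast hab), hS])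
    (fun a ha => by
      obtain ⟨b, -, rfl⟩ := Finset.mem_image.1 ha
      have := b.is_lt
      omega)
  obtain ⟨S', hS', hr⟩ := key
  have himg : S' = (Finset.univ.filter fun b : Fin (J.n + 1) => ((b : ℕ) : ℤ) ∈ S').image
      fun b : Fin (J.n + 1) => ((b : ℕ) : ℤ) := by
    ext b
    simp only [Finset.mem_image, Finset.mem_filter, Finset.mem_univ, true_and]
    refine ⟨fun hb => ?_, fun ⟨c, hc, hcb⟩ => hcb ▸ hc⟩
    obtain ⟨⟨hb0, hbn⟩, -⟩ := hr b hb
    refine ⟨⟨b.toNat, by omega⟩, ?_, by simpa using hb0⟩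
    simpa [hb0] using hb
  refine ⟨Finset.univ.filter fun b : Fin (J.n + 1) => ((b : ℕ) : ℤ) ∈ S', ?_, fun b hb => ?_⟩
  · rw [← hS']
    conv_rhs => rw [himg]
    rw [Finset.card_image_of_injective _ fun a b hab => Fin.ext (by exact_mod_cast hab)]
  · obtain ⟨-, a', ha', r1, r2, r3, r4⟩ := hr _ (Finset.mem_filter.1 hb).2
    obtain ⟨a, ha, rfl⟩ := Finset.mem_image.1 ha'
    refine ⟨a, ha, ?_, fun ho => ⟨?_, ?_, ?_⟩⟩
    · rw [Var.forall_iff u]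
      simp only [Interp.pos, Interp.upd, Var.next_next_next, Function.update_self,
        Function.update_of_ne (Var.ne_next u), Function.update_of_ne (Var.ne_next_next u)]
      exact ⟨Desc.rel_left_of_merge h1, r4,
        Desc.rel_neg_of_flip r3 (by simp [Interp.pos]) (by simp [Interp.pos])⟩
    · rw [Var.forall_iff u]
      simp only [Interp.pos, Interp.upd, Function.update_self,
        Function.update_of_ne (Var.ne_next u), Function.update_of_ne (Var.ne_next_next u)]
      simp only [ho, if_true] at r1
      exact ⟨by simpa using r1, h2.mono (by simp), h3.mono (by simp)⟩
    · rw [Var.forall_iff u]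
      simp only [Interp.pos, Interp.upd, Function.update_self,
        Function.update_of_ne (Var.ne_next u), Function.update_of_ne (Var.ne_next_next u)]
      simp only [ho, if_true] at r2
      exact ⟨by simpa using r2, h4.mono (by simp), h5.mono (by simp)⟩
    · exact hmm.mono (by simp)

end State

/-! ### The cost of a quantifier. -/

open Desc

/-- An isolated point does not pay for `μ` in `reach`; a threshold pays only for the mark of the
other description, hence at most one. -/
theorem Desc.reach_le {d : Desc} {c m k μ : ℕ} (hc : d.eff ≤ c) (hμ : μ ≤ d.mark + 1) :
    d.reach m k μ ≤ m + c + k + 1 := by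
  cases d <;> simp only [reach, eff, mark] at * <;> omega

theorem Desc.mark_le_ne (d : Desc) : d.mark ≤ d.ne := by
  cases d <;> simp [mark, ne]

/-- Quantification decreases the number of links, and the description that remains is small. -/
theorem Desc.eff_merge_comb_le (f d e : Desc) (k c : ℕ) (hde : d.eff + e.eff ≤ c)
    (hfd : f.eff + d.eff ≤ c) (h : d ≠ free ∨ e ≠ free) :
    ∃ r, (f.merge (comb (k + 1) d e)).ne + r + 1 ≤ f.ne + d.ne + e.ne ∧
      (f.merge (comb (k + 1) d e)).eff ≤ c + k + 1 + r := by
  cases f <;> cases d <;> cases e <;> simp only [comb, ne_eq, not_true, or_self] at h ⊢ <;>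
    first
    | exact ⟨0, by simp [Desc.merge, ne], by simp only [Desc.merge, eff] at *; omega⟩
    | exact ⟨1, by simp [Desc.merge, ne], by simp only [Desc.merge, eff] at *; omega⟩
    | (split_ifs
       · exact ⟨0, by simp [Desc.merge, ne], by simp only [Desc.merge, eff] at *; omega⟩
       · first
         | exact ⟨0, by simp [Desc.merge, ne], by simp only [Desc.merge, eff] at *; omega⟩
         | exact ⟨1, by simp [Desc.merge, ne], by simp only [Desc.merge, eff] at *; omega⟩)

/-- Since `N` grows by one more than `c`, the difference of squares grows by at least `2 * N + 2 * A
+ 1`. Strictness `c < N` supplies the remaining slack for borders that were already seen. -/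
theorem sq_add_le_of_lt {c β N k A : ℕ} (h : c ^ 2 + β ≤ N ^ 2) (hN : c + 1 ≤ N) (hA : k + 1 ≤ A) :
    (c + A) ^ 2 + (β + 2 * c + 2 * k + 4) ≤ (N + A + 1) ^ 2 := by
  have := Nat.mul_le_mul_right (A + 1) hN
  ring_nf at *
  linarith

theorem sq_add_le_of_le {c β N k A : ℕ} (h : c ^ 2 + β ≤ N ^ 2) (hN : c ≤ N) (hA : k + 1 ≤ A) :
    (c + A) ^ 2 + (β + 2 * c + 2 * k + 2) ≤ (N + A + 1) ^ 2 := by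
  have := Nat.mul_le_mul_right (A + 1) hN
  ring_nf at *
  linarith

namespace State

/-- If `u` has no links, `N` may grow by `k + 1` at fixed `c`. Otherwise `r + 1` links disappear, so
`N` may grow by `k + 2 + r` while `c` grows by `k + 1 + r`. Either way `N` plus links grows by at
most `k + 1 ≤ t`. -/
theorem Bounded.quant {s : State} {M : ℕ} (h : s.Bounded M) {k t : ℕ} (hk : k + 1 ≤ t) (u : Var) :
    (s.quant k u).Bounded (M + t) := by
  obtain ⟨c, β, N, h1, h2, h3, h4, h5, h6⟩ := h
  have hcN : c ≤ N := by nlinarith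
  have hlinks := s.links_eq u
  obtain ⟨d, hd⟩ : ∃ d, d = (s.D u.next.next).flip := ⟨_, rfl⟩
  obtain ⟨e, he⟩ : ∃ e, e = s.D u.next := ⟨_, rfl⟩
  have hde : d.eff + e.eff ≤ c := by
    rw [hd, he, eff_flip]
    exact h1 _ _ (Var.ne_next _)
  have hfd : (s.D u).eff + d.eff ≤ c := by
    rw [hd, eff_flip]
    exact h1 _ _ (Var.ne_next_next _).symm
  have hlinks' : (s.quant k u).links = ((s.D u).merge (comb (k + 1) d e)).ne := by
    rw [links_eq _ u]
    simp [State.quant, Var.ne_next u, Var.ne_next_next u, ne, hd, he]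
  have hdn : d.ne = (s.D u.next.next).ne := by rw [hd, ne_flip]
  have hDu : (s.quant k u).D u = (s.D u).merge (comb (k + 1) d e) := by simp [State.quant, hd, he]
  have hDo : ∀ i, i ≠ u → (s.quant k u).D i = .free := fun i hi => by simp [State.quant, hi]
  have hD : ∀ C, ((s.D u).merge (comb (k + 1) d e)).eff ≤ C →
      ∀ i j, i ≠ j → ((s.quant k u).D i).eff + ((s.quant k u).D j).eff ≤ C := by
    intro C hC i j hij
    by_cases hi : i = u
    · subst hi
      rw [hDu, hDo j hij.symm]
      simpa [eff] using hC
    · by_cases hj : j = u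
      · subst hj
        rw [hDu, hDo i hi]
        simpa [eff] using hC
      · rw [hDo i hi, hDo j hj]
        simp [eff]
  obtain ⟨m, hm⟩ : ∃ m, m = if s.o then s.mn u + 1 else 0 := ⟨_, rfl⟩
  obtain ⟨m', hm'⟩ : ∃ m, m = if s.o then s.mx u + 1 else 0 := ⟨_, rfl⟩
  have hmm : (s.quant k u).mm = max s.mm (m + m' + k + (d.mark + e.mark)) := by
    simp only [State.quant, hd, he, hm, hm']
  have hmn : ∀ i, (s.quant k u).mn i = if i = u.next then
      max (s.mn u.next) (d.reach m k (d.mark + e.mark)) else if i = u.next.next then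
      max (s.mn u.next.next) (e.reach m k (d.mark + e.mark)) else 0 := fun i => by
    simp only [State.quant, hd, he, hm]
  have hmx : ∀ i, (s.quant k u).mx i = if i = u.next then
      max (s.mx u.next) (d.reach m' k (d.mark + e.mark)) else if i = u.next.next then
      max (s.mx u.next.next) (e.reach m' k (d.mark + e.mark)) else 0 := fun i => by
    simp only [State.quant, hd, he, hm']
  have huu := h2 u u
  by_cases hfree : d = .free ∧ e = .free
  · have hmn' : ∀ i, (s.quant k u).mn i ≤ s.mn i := fun i => by
      rw [hmn]
      split_ifs with hi hi <;> simp [hi, hfree.1, hfree.2, reach]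
    have hmx' : ∀ i, (s.quant k u).mx i ≤ s.mx i := fun i => by
      rw [hmx]
      split_ifs with hi hi <;> simp [hi, hfree.1, hfree.2, reach]
    rw [← hdn, ← he, hfree.1, hfree.2] at hlinks
    rw [hfree.1, hfree.2] at hlinks' hmm hD
    have e1 : ((s.D u).merge (comb (k + 1) free free)).ne = (s.D u).ne := by
      cases s.D u <;> simp [Desc.merge, comb, ne]
    have e2 : ((s.D u).merge (comb (k + 1) free free)).eff ≤ c := by
      have : ((s.D u).merge (comb (k + 1) free free)).eff = (s.D u).eff := by
        cases s.D u <;> simp [Desc.merge, comb, eff]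
      omega
    simp only [show Desc.free.ne = 0 from rfl, show Desc.free.mark = 0 from rfl] at hlinks hmm
    -- Both border thresholds of `u` increase by one if they were in use, hence the additional `2`
    -- over `β + k`; if not, `β + k + 1` keeps the border bound positive.
    refine ⟨c, if s.o then β + k + 2 else β + k + 1, N + k + 1, hD c e2, ?_, ?_, ?_, ?_, ?_⟩
    · intro v w
      have f1 := h2 v w
      have f2 := hmn' v
      have f3 := hmx' w
      split_ifs <;> omega
    · cases ho : s.o <;> simp only [ho, if_true, if_false, Bool.false_eq_true] at hm hm' ⊢ <;> omega
    · split_ifs <;> omega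
    · split_ifs with ho
      · have hN : 1 ≤ N := by
          have := h4 ho
          by_contra hN
          have : N = 0 := by omega
          subst this
          omega
        nlinarith
      · nlinarith
    · omega
  · have hmk : d.mark + e.mark ≤ d.mark + 1 := by
      have := e.mark_le_ne
      have := e.ne_le_one
      omega
    have hmk' : d.mark + e.mark ≤ e.mark + 1 := by
      have := d.mark_le_ne
      have := d.ne_le_one
      omega
    have hmn' : ∀ i, (s.quant k u).mn i ≤ max (s.mn i) (m + c + k + 1) := fun i => by
      rw [hmn]
      have f1 := reach_le (d := d) (c := c) (m := m) (k := k) (by omega) hmk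
      have f2 := reach_le (d := e) (c := c) (m := m) (k := k) (by omega) hmk'
      split_ifs with hi hi
      · subst hi; omega
      · subst hi; omega
      · omega
    have hmx' : ∀ i, (s.quant k u).mx i ≤ max (s.mx i) (m' + c + k + 1) := fun i => by
      rw [hmx]
      have f1 := reach_le (d := d) (c := c) (m := m') (k := k) (by omega) hmk
      have f2 := reach_le (d := e) (c := c) (m := m') (k := k) (by omega) hmk'
      split_ifs with hi hi
      · subst hi; omega
      · subst hi; omega
      · omega
    obtain ⟨r, hr, hr'⟩ := eff_merge_comb_le (s.D u) d e k c hde hfd (by tauto)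
    have hmark : d.mark + e.mark ≤ 2 := by
      have := e.mark_le_ne
      have := e.ne_le_one
      have := d.mark_le_ne
      have := d.ne_le_one
      omega
    refine ⟨c + (k + 1 + r), if s.o then β + 2 * c + 2 * k + 4 else β + 2 * c + 2 * k + 2,
      N + (k + 1 + r) + 1, hD _ (by omega), ?_, ?_, ?_, ?_, ?_⟩
    · intro v w
      have f1 := h2 v w
      have f2 := hmn' v
      have f3 := hmx' w
      have f4 := h2 v u
      have f5 := h2 u w
      cases ho : s.o <;> simp only [ho, if_true, if_false, Bool.false_eq_true] at hm hm' ⊢ <;> omega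
    · cases ho : s.o <;> simp only [ho, if_true, if_false, Bool.false_eq_true] at hm hm' ⊢ <;> omega
    · split_ifs <;> omega
    · split_ifs with ho
      -- A state that sees the borders has `β ≥ 1`, so `N = c` would violate `c ^ 2 + β ≤ N ^ 2`.
      · have hN : c + 1 ≤ N := by
          have := h4 ho
          by_contra hN
          have : N = c := by omega
          subst this
          omega
        exact sq_add_le_of_lt h5 hN (by omega)
      · exact sq_add_le_of_le h5 hcN (by omega)
    · rw [← hdn, ← he] at hlinks
      omega

end State

/-! ### Induction on formulas. -/

/-- A property of interpretations that is seen by a state bounded by `M`. -/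
def Admissible (M : ℕ) (Φ : Interp → Prop) : Prop :=
  ∃ s : State, (∀ i, s.D i ≠ .pt 0) ∧ (∀ I J, s.Rel I J → Φ I → Φ J) ∧ s.Bounded M

theorem Admissible.mono {M M' : ℕ} {Φ : Interp → Prop} (h : Admissible M Φ) (hM : M ≤ M') :
    Admissible M' Φ := by
  obtain ⟨s, h1, h2, h3⟩ := h
  exact ⟨s, h1, h2, h3.mono hM⟩

theorem Admissible.not {M : ℕ} {Φ : Interp → Prop} (h : Admissible M Φ) :
    Admissible M fun I => ¬ Φ I := by
  obtain ⟨s, h1, h2, h3⟩ := h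
  exact ⟨s, h1, fun I J hr hI hJ => hI (h2 J I hr.symm hJ), h3⟩

theorem Admissible.and {M M' : ℕ} {Φ Φ' : Interp → Prop} (h : Admissible M Φ)
    (h' : Admissible M' Φ') : Admissible (M + M') fun I => Φ I ∧ Φ' I := by
  obtain ⟨s, h1, h2, h3⟩ := h
  obtain ⟨s', h1', h2', h3'⟩ := h'
  exact ⟨s.merge s', fun i => Desc.merge_ne_pt_zero (h1 i) (h1' i),
    fun I J hr hI => ⟨h2 I J hr.left hI.1, h2' I J hr.right hI.2⟩, h3.merge h3'⟩

theorem Admissible.or {M M' : ℕ} {Φ Φ' : Interp → Prop} (h : Admissible M Φ)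
    (h' : Admissible M' Φ') : Admissible (M + M') fun I => Φ I ∨ Φ' I := by
  simpa [or_iff_not_and_not] using (h.not.and h'.not).not

theorem admissible_const (M : ℕ) (p : Prop) : Admissible M fun _ => p :=
  ⟨⟨fun _ => .free, false, 0, 0, 0⟩, by simp, fun _ _ _ h => h,
    0, 0, 0, by simp [Desc.eff], by simp, by simp, by simp, by simp, by simp [State.links, Desc.ne]⟩

/-- A property that only depends on what a description with no effect sees of one pair of
variables. -/
theorem admissible_of_inner {M : ℕ} (hM : 1 ≤ M) {Φ : Interp → Prop} (i : Var) (d : Desc)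
    (hd : d ≠ .pt 0) (he : d.eff = 0) (h : ∀ I J : Interp, d.Rel (I.pos i.next.next - I.pos i.next)
      (J.pos i.next.next - J.pos i.next) → Φ I → Φ J) : Admissible M Φ := by
  refine ⟨⟨fun j => if j = i then d else .free, false, 0, 0, 0⟩, fun j => ?_,
    fun I J hr => h I J (by simpa using hr.1 i), 0, 0, 0, fun j l _ => ?_, by simp, by simp, by simp,
    by simp, ?_⟩
  · dsimp only
    split_ifs <;> simp [hd]
  · dsimp only
    have hf : Desc.free.eff = 0 := rfl
    split_ifs <;> simp only [he, hf, add_zero, le_refl]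
  · rw [State.links_eq _ i]
    have := d.ne_le_one
    have hf : Desc.free.ne = 0 := rfl
    simp only [Var.ne_next, Var.ne_next_next, if_true, if_false, hf]
    omega

/-- A property that only depends on the distance of two terms, one of them a constant, up to the
threshold `1`. -/
theorem admissible_of_outer {M : ℕ} (hM : 1 ≤ M) {Φ : Interp → Prop} (mn mx : Var → ℕ) (mm : ℕ)
    (hm : ∀ v w, mn v + mx w ≤ 1) (hmm : mm ≤ 1)
    (h : ∀ I J : Interp, (∀ v, ThrRel (mn v) (I.pos v) (J.pos v)) →
      (∀ v, ThrRel (mx v) (I.n - I.pos v) (J.n - J.pos v)) → ThrRel mm I.n J.n → Φ I → Φ J) :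
    Admissible M Φ :=
  ⟨⟨fun _ => .free, true, mn, mx, mm⟩, by simp,
    fun I J hr => h I J (hr.2 rfl).1 (hr.2 rfl).2.1 (hr.2 rfl).2.2,
    0, 1, 1, by simp [Desc.eff], hm, hmm, by simp, by simp, by simpa [State.links, Desc.ne] using hM⟩

theorem admissible_atom {M : ℕ} (hM : 1 ≤ M) (r : Rel) (s s' : Tm) :
    Admissible M fun I => (Formula.atom r s s').Sat I.α := by
  have lo : ∀ (v : Var) (Φ : Interp → Prop), (∀ I J : Interp, ThrRel 1 (I.pos v) (J.pos v) →
      Φ I → Φ J) → Admissible M Φ := fun v Φ h =>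
    admissible_of_outer hM 1 0 0 (by simp) (by simp) fun I J h1 _ _ => h I J (h1 v)
  have hi : ∀ (v : Var) (Φ : Interp → Prop), (∀ I J : Interp,
      ThrRel 1 (I.n - I.pos v) (J.n - J.pos v) → Φ I → Φ J) → Admissible M Φ := fun v Φ h =>
    admissible_of_outer hM 0 1 0 (by simp) (by simp) fun I J _ h1 _ => h I J (h1 v)
  have lohi : ∀ (Φ : Interp → Prop), (∀ I J : Interp, ThrRel 1 I.n J.n → Φ I → Φ J) →
      Admissible M Φ := fun Φ h =>
    admissible_of_outer hM 0 0 1 (by simp) (by simp) fun I J _ _ h1 => h I J h1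
  have lt : ∀ (v : Var) (I : Interp), I.pos v ≤ I.n := fun v I => by
    have := (I.α v).is_lt
    simp only [Interp.pos]
    omega
  have self : ∀ s : Tm, Admissible M fun I => (Formula.atom r s s).Sat I.α := fun s => by
    cases r
    · simpa [Formula.Sat, Rel.holds] using admissible_const M True
    · simpa [Formula.Sat, Rel.holds] using admissible_const M False
    · simpa [Formula.Sat, Rel.holds] using admissible_const M False
  have inner : ∀ (i : Var) (u v : Tm), (∀ I : Interp, (u.val I.α : ℤ) = I.pos i.next) →
      (∀ I : Interp, (v.val I.α : ℤ) = I.pos i.next.next) →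
      Admissible M (fun I => (Formula.atom r u v).Sat I.α) ∧
        Admissible M fun I => (Formula.atom r v u).Sat I.α := fun i u v hu hv => by
    cases r
    · constructor <;> refine admissible_of_inner hM i (.thr 0) (by simp) rfl fun I J h => ?_ <;>
        simp only [Formula.Sat, Rel.holds, Desc.Rel, ThrRel, ← hu, ← hv] at * <;> omega
    · constructor <;> refine admissible_of_inner hM i (.thr 0) (by simp) rfl fun I J h => ?_ <;>
        simp only [Formula.Sat, Rel.holds, Desc.Rel, ThrRel, ← hu, ← hv] at * <;> omega
    · constructor
      -- A threshold `1` would cost one for the centre and one for the link, too much when `M = 1`;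
      -- the isolated point has `eff = 0`.
      · refine admissible_of_inner hM i (.pt 1) (by simp) rfl fun I J h => ?_
        simp only [Formula.Sat, Rel.holds, Desc.Rel, ← hu, ← hv] at *
        omega
      · refine admissible_of_inner hM i (.pt (-1)) (by simp) rfl fun I J h => ?_
        simp only [Formula.Sat, Rel.holds, Desc.Rel, ← hu, ← hv] at *
        omega
  have border : ∀ (v : Var) (u : Tm), (∀ I : Interp, (u.val I.α : ℤ) = I.pos v) →
      (Admissible M (fun I => (Formula.atom r .min u).Sat I.α) ∧
        Admissible M fun I => (Formula.atom r u .min).Sat I.α) ∧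
      (Admissible M (fun I => (Formula.atom r .max u).Sat I.α) ∧
        Admissible M fun I => (Formula.atom r u .max).Sat I.α) := fun v u hu => by
    refine ⟨⟨lo v _ ?_, lo v _ ?_⟩, hi v _ ?_, hi v _ ?_⟩ <;> intro I J h <;>
      have h1 := lt v I <;> have h2 := lt v J <;>
      cases r <;> simp only [Formula.Sat, Rel.holds, ThrRel, ← hu, Tm.val] at * <;> omega
  cases s <;> cases s' <;>
    first
    | exact self _
    | exact (border .x .x fun _ => rfl).1.1
    | exact (border .x .x fun _ => rfl).1.2
    | exact (border .x .x fun _ => rfl).2.1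
    | exact (border .x .x fun _ => rfl).2.2
    | exact (border .y .y fun _ => rfl).1.1
    | exact (border .y .y fun _ => rfl).1.2
    | exact (border .y .y fun _ => rfl).2.1
    | exact (border .y .y fun _ => rfl).2.2
    | exact (border .z .z fun _ => rfl).1.1
    | exact (border .z .z fun _ => rfl).1.2
    | exact (border .z .z fun _ => rfl).2.1
    | exact (border .z .z fun _ => rfl).2.2
    | exact (inner .x .y .z (fun _ => rfl) fun _ => rfl).1
    | exact (inner .x .y .z (fun _ => rfl) fun _ => rfl).2
    | exact (inner .y .z .x (fun _ => rfl) fun _ => rfl).1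
    | exact (inner .y .z .x (fun _ => rfl) fun _ => rfl).2
    | exact (inner .z .x .y (fun _ => rfl) fun _ => rfl).1
    | exact (inner .z .x .y (fun _ => rfl) fun _ => rfl).2
    | (refine lohi _ fun I J h => ?_
       cases r <;> simp only [Formula.Sat, Rel.holds, Tm.val, ThrRel] at * <;> omega)

theorem Admissible.atLeast {M k t : ℕ} (hk : k ≤ t) {Φ : Interp → Prop} (h : Admissible M Φ)
    (u : Var) : Admissible (M + t) fun I =>
      ∃ S : Finset (Fin (I.n + 1)), S.card = k ∧ ∀ a ∈ S, Φ (I.upd u a) := by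
  rcases k with _ | k
  · simpa using admissible_const (M + t) True
  obtain ⟨s, h1, h2, h3⟩ := h
  refine ⟨s.quant k u, fun i => ?_, fun I J hr => ?_, h3.quant hk u⟩
  · simp only [State.quant]
    split_ifs
    · exact Desc.merge_ne_pt_zero (h1 _) (Desc.comb_ne_pt_zero _ _ _)
    · simp
  · rintro ⟨S, hS, hI⟩
    obtain ⟨S', hS', hr'⟩ := s.exists_rel_of_quant h1 k u hr S hS
    refine ⟨S', hS', fun b hb => ?_⟩
    obtain ⟨a, ha, hab⟩ := hr' b hb
    exact h2 _ _ hab (hI a ha)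

theorem Formula.admissible {t : ℕ} (ht : 1 ≤ t) (ψ : Formula) (hψ : ψ.countingRank ≤ t) :
    Admissible (t * ψ.size) fun I => ψ.Sat I.α := by
  induction ψ with
  | atom r s s' => exact admissible_atom (by simpa [Formula.size] using ht) r s s'
  | neg φ ih => exact (ih hψ).not.mono (Nat.mul_le_mul_left t (Nat.le_succ _))
  | or φ χ ih ih' =>
    simp only [Formula.countingRank, max_le_iff] at hψ
    exact ((ih hψ.1).or (ih' hψ.2)).mono (mul_add _ _ _).ge
  | and φ χ ih ih' =>
    simp only [Formula.countingRank, max_le_iff] at hψ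
    exact ((ih hψ.1).and (ih' hψ.2)).mono (mul_add _ _ _).ge
  | atLeast k u φ ih =>
    simp only [Formula.countingRank, max_le_iff] at hψ
    exact ((ih hψ.2).atLeast hψ.1 u).mono (by simp only [Formula.size]; ring_nf; rfl)
  | forallAtLeast k u φ ih =>
    simp only [Formula.countingRank, max_le_iff] at hψ
    exact ((ih hψ.2).not.atLeast hψ.1 u).not.mono (by simp only [Formula.size]; ring_nf; rfl)

/-! ### From states to separators. -/

namespace State

/-- The value of the separator of a state at an ordered pair of terms. -/
def sep (s : State) : Tm → Tm → ℕ
  | .min, .max | .max, .min => s.mm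
  | .min, .x | .x, .min => s.mn .x
  | .min, .y | .y, .min => s.mn .y
  | .min, .z | .z, .min => s.mn .z
  | .max, .x | .x, .max => s.mx .x
  | .max, .y | .y, .max => s.mx .y
  | .max, .z | .z, .max => s.mx .z
  | .y, .z | .z, .y => (s.D .x).val
  | .x, .z | .z, .x => (s.D .y).val
  | .x, .y | .y, .x => (s.D .z).val
  | _, _ => 0

/-- The separator of a state. -/
def toSeparator (s : State) : Separator := fun p =>
  (Finset.univ.filter fun q : Tm × Tm => p.1 = {q.1, q.2}).sup fun q => s.sep q.1 q.2

theorem sep_comm (s : State) (u u' : Tm) : s.sep u u' = s.sep u' u := by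
  cases u <;> cases u' <;> rfl

theorem toSeparator_mkPair (s : State) (u u' : Tm) (h : u ≠ u') :
    s.toSeparator (mkPair u u' h) = s.sep u u' := by
  refine le_antisymm (Finset.sup_le fun q hq => ?_)
    (Finset.le_sup (f := fun q : Tm × Tm => s.sep q.1 q.2) (b := (u, u')) (Finset.mem_filter.2 ⟨Finset.mem_univ _, rfl⟩))
  replace hq : ({u, u'} : Finset Tm) = {q.1, q.2} := (Finset.mem_filter.1 hq).2
  obtain ⟨h1, h2⟩ | ⟨h1, h2⟩ : u = q.1 ∧ u' = q.2 ∨ u = q.2 ∧ u' = q.1 := by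
    obtain ⟨a, b⟩ := q
    revert h hq
    revert u u' a b
    decide
  · rw [h1, h2]
  · rw [h1, h2, sep_comm]

/-- Equal order types fix the signs, so agreement of distances up to a threshold becomes agreement
of signed differences. -/
theorem rel_of_not_separated (s : State) {I J : Interp} (h : ∀ (u u' : Tm) (h : u ≠ u'),
    ¬ (cmp (I.val u) (I.val u') ≠ cmp (J.val u) (J.val u') ∨
      (min (dist (I.val u) (I.val u')) (dist (J.val u) (J.val u')) ≤ s.toSeparator (mkPair u u' h) ∧
        dist (I.val u) (I.val u') ≠ dist (J.val u) (J.val u')))) : s.Rel I J := by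
  have key : ∀ u u', u ≠ u' →
      ThrRel (s.sep u u') ((I.val u' : ℤ) - I.val u) (J.val u' - J.val u) := by
    intro u u' huu
    have h1 := h u u' huu
    rw [toSeparator_mkPair] at h1
    push Not at h1
    obtain ⟨h1, h2⟩ := h1
    have e1 : I.val u < I.val u' ↔ J.val u < J.val u' := by
      rw [← cmp_eq_lt_iff, h1, cmp_eq_lt_iff]
    have e2 : I.val u = I.val u' ↔ J.val u = J.val u' := by
      rw [← cmp_eq_eq_iff, h1, cmp_eq_eq_iff]
    simp only [ThrRel, dist] at *
    omega
  have lo : ∀ v, ThrRel (s.mn v) (I.pos v) (J.pos v) := fun v => by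
    have := key .min v.toTm v.min_ne
    cases v <;> simpa [sep, Interp.val, Tm.val, Var.toTm, Interp.pos] using this
  have hi : ∀ v, ThrRel (s.mx v) (I.n - I.pos v) (J.n - J.pos v) := fun v => by
    have := key v.toTm .max v.ne_max
    cases v <;> simpa [sep, Interp.val, Tm.val, Var.toTm, Interp.pos] using this
  refine ⟨fun i => ?_, fun _ => ⟨lo, hi, ?_⟩⟩
  · refine Desc.rel_of_thr le_rfl ?_
    have := key i.next.toTm i.next.next.toTm (by cases i <;> decide)
    cases i <;> simpa [sep, Interp.val, Tm.val, Var.toTm, Interp.pos, Var.next] using this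
  · simpa [sep, Interp.val, Tm.val] using key .min .max (by decide)

theorem borderDist_le (s : State) {β : ℕ} (h : ∀ v w, s.mn v + s.mx w ≤ β) (hm : s.mm ≤ β) :
    borderDist s.toSeparator ≤ β := by
  refine max_le ?_ (Finset.sup_le fun q _ => ?_)
  · rw [toSeparator_mkPair]
    exact hm
  · rw [toSeparator_mkPair, toSeparator_mkPair]
    have := h q.1 q.2
    obtain ⟨v, w⟩ := q
    cases v <;> cases w <;> exact this

theorem exists_opposite (p : Pair) (hp : p.1 ⊆ {Tm.x, Tm.y, Tm.z}) :
    ∃ i : Var, p.1 = {i.next.toTm, i.next.next.toTm} := by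
  obtain ⟨a, b, hab, h⟩ := Finset.card_eq_two.1 p.2
  have ha : a ∈ ({Tm.x, Tm.y, Tm.z} : Finset Tm) := hp (by simp [h])
  have hb : b ∈ ({Tm.x, Tm.y, Tm.z} : Finset Tm) := hp (by simp [h])
  rw [h]
  clear h hp
  revert a b
  decide

/-- Here the remaining links are spent: each of the two pairs of variables involved pays one to pass
from `eff` to `val`. -/
theorem centreDist_le (s : State) {c : ℕ} (h : ∀ i j, i ≠ j → (s.D i).eff + (s.D j).eff ≤ c) :
    centreDist s.toSeparator ≤ c + s.links := by
  refine Finset.sup_le fun r hr => ?_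
  obtain ⟨h1, h2, h3⟩ := (Finset.mem_filter.1 hr).2
  obtain ⟨i, hi⟩ := exists_opposite _ h1
  obtain ⟨j, hj⟩ := exists_opposite _ h2
  have val : ∀ (p : Pair) (i : Var), p.1 = {i.next.toTm, i.next.next.toTm} →
      s.toSeparator p = (s.D i).val := by
    intro p i hp
    have hne : i.next.toTm ≠ i.next.next.toTm := by cases i <;> decide
    rw [show p = mkPair _ _ hne from Subtype.ext hp, toSeparator_mkPair]
    cases i <;> rfl
  have hij : i ≠ j := by
    rintro rfl
    exact h3 (Subtype.ext (hi.trans hj.symm))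
  rw [val _ i hi, val _ j hj]
  have e1 := h i j hij
  have e2 := (s.D i).val_le
  have e3 := (s.D j).val_le
  have e4 : (s.D i).ne + (s.D j).ne ≤ s.links := by
    simp only [links]
    cases i <;> cases j <;> first | exact absurd rfl hij | omega
  omega

theorem weight_le (s : State) {M : ℕ} (h : s.Bounded M) : weight s.toSeparator ≤ M := by
  obtain ⟨c, β, N, h1, h2, h3, -, h5, h6⟩ := h
  have hc := s.centreDist_le h1
  have hb := s.borderDist_le h2 h3
  refine Real.sqrt_le_iff.2 ⟨Nat.cast_nonneg _, ?_⟩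
  have hcN : c ≤ N := by nlinarith
  have : centreDist s.toSeparator ^ 2 + borderDist s.toSeparator ≤ M ^ 2 :=
    calc centreDist s.toSeparator ^ 2 + borderDist s.toSeparator ≤ (c + s.links) ^ 2 + β :=
          add_le_add (Nat.pow_le_pow_left hc 2) hb
      _ ≤ (N + s.links) ^ 2 := by nlinarith [Nat.mul_le_mul_right s.links hcN]
      _ ≤ M ^ 2 := Nat.pow_le_pow_left h6 2
  exact_mod_cast this

end State

end OrderLogic

/-- A three-variable counting formula of counting rank at most `t` that distinguishes two sets of
interpretations over finite linear orders has size at least `w(δ) / t`, for `δ` a minimal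
separator. -/
theorem theorem7 (t : ℕ) (ht : 1 ≤ t) (ψ : OrderLogic.Formula) (hψ : ψ.countingRank ≤ t)
    (A B : Set OrderLogic.Interp) (hAB : OrderLogic.Distinguishes A B ψ)
    (δ : OrderLogic.Separator) (hδ : OrderLogic.IsMinimalSeparator A B δ) :
    (ψ.size : ℝ) ≥ OrderLogic.weight δ / (t : ℝ) := by
  obtain ⟨s, -, hs, hb⟩ := ψ.admissible ht hψ
  have hsep : OrderLogic.IsSeparator A B s.toSeparator := by
    intro I hI J hJ
    by_contra hc
    push Not at hc
    exact hAB.2 J hJ (hs I J (s.rel_of_not_separated fun u u' h hh => by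
      rcases hh with hh | hh
      · exact hh (hc u u' h).1
      · exact hh.2 ((hc u u' h).2 hh.1)) (hAB.1 I hI))
  have hw : OrderLogic.weight δ ≤ (t * ψ.size : ℕ) := (hδ.2 _ hsep).trans (s.weight_le hb)
  rw [ge_iff_le, div_le_iff₀ (by exact_mod_cast ht)]
  push_cast at hw
  linarith
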